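/- **Theorem (criterion of completeness for reductions).** Let $(M,\omega)$ be a complex manifold with a holomorphic symplectic form $\omega$ (a closed, holomorphic 2-form of type $(2,0)$ that is nondegenerate on $T^{1,0}M$), with complex structure $\mathcal J$ on $TM$, and let $c=\omega^{-1}$ be the inverse holomorphic bivector, regarded as a section of $\bigwedge^2T^{\mathbb C}M$. For $\lambda=(\lambda_1,\lambda_2)\in\mathbb C^2$ put $c_\lambda=\lambda_1\operatorname{Re}c+\lambda_2\operatorname{Im}c$, and let $\Lambda=\operatorname{Span}_{\mathbb C}\{(1,\mathrm i)\}\cup\operatorname{Span}_{\mathbb C}\{(1,-\mathrm i)\}\subset\mathbb C^2$; for $\lambda\notin\Lambda$ the bivector $c_\lambda$ is nondegenerate, and $\omega_\lambda=(c_\lambda)^{-1}$ denotes the inverse 2-form on $T^{\mathbb C}M$. Let $p:M\to M'$ be a smooth surjective submersion onto a smooth manifold with connected fibres, and let $\mathcal K$ be the foliation of $M$ by the fibres of $p$. Assume that $\mathcal K$ is a generic CR-foliation, i.e. $\dim T^{1,0}_x\mathcal K$ is constant along each leaf and $T_x\mathcal K+\mathcal JT_x\mathcal K=T_xM$ for all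 $x$, where $T^{1,0}_x\mathcal K=T^{\mathbb C}_x\mathcal K\cap T^{1,0}_xM$. Assume also that $c$ is projectable along $p$ (in local coordinates $(x,y)$ adapted to $p$, with $y$ coming from $M'$, the coefficients of $c$ at $\partial_{y^i}\wedge\partial_{y^j}$ depend on $y$ only), with push-forward $c'\in\Gamma(\bigwedge^2T^{\mathbb C}M')$, $c'(p(x))=\bigwedge^2p_*\,c(x)$. Put $c'_\lambda=\lambda_1\operatorname{Re}c'+\lambda_2\operatorname{Im}c'$. For a bivector $b$ at a point, $P_b$ denotes the image of its sharp map $b^\sharp$ from covectors to vectors, and the rank of $b$ is $\dim P_b$. For $x\in M$ and $\lambda\in\mathbb C^2\setminus\Lambda$ set $$k^x_\lambda=\dim_{\mathbb C}\bigl(T^{\mathbb C}_x\mathcal K\cap(T^{\mathbb C}_x\mathcal K)^{\perp\omega_\lambda}\bigr),\qquad k^x=\dim_{\mathbb C}\bigl(T^{1,0}_x\mathcal K\cap(T^{1,0}_x\mathcal K)^{\perp\omega}\bigr),$$ where the skew-orthogonal complements are taken in $T^{\mathbb C}_xM$ with respect to $\omega_\lambda(x)$ and in $T^{1,0}_xM$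 with respect to $\omega(x)$, respectively. Then, for every $x\in M$ and $x'=p(x)$: 1. $k^x_\lambda=\operatorname{codim}_{\mathbb C}P_{c'_\lambda,x'}$ for every $\lambda\in\mathbb C^2\setminus\Lambda$; 2. $k^x=\operatorname{codim}_{\mathbb C}P_{c',x'}=\operatorname{codim}_{\mathbb C}P_{\bar c',x'}$. In particular these numbers depend only on $x'$ (and $\lambda$); write $k^{x'}_\lambda$ and $k^{x'}$ for them. 3. Suppose moreover that $\operatorname{Re}c'$ and $\operatorname{Im}c'$ are linearly independent over $\mathbb R$ or both zero, so that the reduced bihamiltonian structure $J'=\operatorname{Span}_{\mathbb R}\{\operatorname{Re}c',\operatorname{Im}c'\}$ is defined. Call $J'$ complete at $x'$ if $\operatorname{rank}b(x')=R_0'$ for every nonzero $b$ in the complex span of $J'$, where $R_0'$ is the maximum of $\operatorname{rank}b(y')$ over all $b\in J'$ and $y'\in M'$. Then $J'$ is complete at $x'$ if and only if there is a number $k$ such that (i) $k^{x'}_\lambda=k$ for all $\lambda\in\mathbb C^2\setminus\Lambda$; (ii) $k^{x'}=k$; (iii) $k=\min_{y'\in M'}k^{y'}_\lambda$ for every $\lambda\in\mathbb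 C^2\setminus\Lambda$. -/

import Mathlib

open scoped Manifold ContDiff TensorProduct Topology

noncomputable section

namespace SymplecticReduction

/-! ### Linear algebra: 2-forms, bivectors, their inverses and characteristic subspaces -/

section LinearAlgebra

/-- The space of 2-forms (alternating bilinear forms) on a vector space `W`. -/
def TwoForm (𝕜 W : Type*) [Field 𝕜] [AddCommGroup W] [Module 𝕜 W] :
    Submodule 𝕜 (LinearMap.BilinForm 𝕜 W) where
  carrier := {B | B.IsAlt}
  zero_mem' := fun _ => rfl
  add_mem' := fun {a b} ha hb v => by simp [ha v, hb v]
  smul_mem' := fun t a ha v => by simp [ha v]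

/-- The space of bivectors on a finite-dimensional vector space `W`: an element of `⋀² W` is
viewed as an alternating bilinear form on the dual space of `W`. -/
abbrev Bivector (𝕜 W : Type*) [Field 𝕜] [AddCommGroup W] [Module 𝕜 W] :
    Submodule 𝕜 (LinearMap.BilinForm 𝕜 (Module.Dual 𝕜 W)) :=
  TwoForm 𝕜 (Module.Dual 𝕜 W)

variable {𝕜 W W' : Type*} [Field 𝕜] [AddCommGroup W] [Module 𝕜 W]
  [AddCommGroup W'] [Module 𝕜 W']

/-- Pull-back of a 2-form under a linear map. -/
def TwoForm.comap (f : W →ₗ[𝕜] W') (B : TwoForm 𝕜 W') : TwoForm 𝕜 W :=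
  ⟨B.1.compl₁₂ f f, fun v => B.2 (f v)⟩

/-- The image `⋀² f (b)` of a bivector `b` under a linear map `f`. -/
def Bivector.map (f : W →ₗ[𝕜] W') (b : Bivector 𝕜 W) : Bivector 𝕜 W' :=
  TwoForm.comap f.dualMap b

/-- The sharp map `W^* → W` of a bivector: evaluate its first argument on a covector. -/
def Bivector.sharp [FiniteDimensional 𝕜 W] (b : Bivector 𝕜 W) : Module.Dual 𝕜 W →ₗ[𝕜] W :=
  (Module.evalEquiv 𝕜 W).symm.toLinearMap ∘ₗ b.1

/-- The characteristic subspace of a bivector: the image of its sharp map. -/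
def Bivector.charSubspace [FiniteDimensional 𝕜 W] (b : Bivector 𝕜 W) : Submodule 𝕜 W :=
  LinearMap.range (Bivector.sharp b)

/-- The rank of a bivector is the rank of its sharp map. -/
def Bivector.rank [FiniteDimensional 𝕜 W] (b : Bivector 𝕜 W) : ℕ :=
  Module.finrank 𝕜 (Bivector.charSubspace b)

/-- The codimension of the characteristic subspace of a bivector. -/
def Bivector.codimChar [FiniteDimensional 𝕜 W] (b : Bivector 𝕜 W) : ℕ :=
  Module.finrank 𝕜 (W ⧸ Bivector.charSubspace b)

open Classical in
/-- The bivector inverse to a nondegenerate 2-form `B`: it is carried to `B` by the second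
exterior power of the isomorphism `w ↦ B(w, ·)`. (The value is `0` if `B` is degenerate.) -/
def TwoForm.inverse (B : TwoForm 𝕜 W) : Bivector 𝕜 W :=
  if h : Function.Bijective B.1 then
    TwoForm.comap (LinearEquiv.ofBijective B.1 h).symm.toLinearMap B
  else 0

open Classical in
/-- The 2-form inverse to a nondegenerate bivector `b`: it is carried to `b` by the second
exterior power of the sharp map of `b`. (The value is `0` if `b` is degenerate.) -/
def Bivector.inverse [FiniteDimensional 𝕜 W] (b : Bivector 𝕜 W) : TwoForm 𝕜 W :=
  if h : Function.Bijective (Bivector.sharp b) then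
    TwoForm.comap (LinearEquiv.ofBijective (Bivector.sharp b) h).symm.toLinearMap b
  else 0

/-- The skew-orthogonal complement of a subspace with respect to a 2-form. -/
def TwoForm.perp (B : TwoForm 𝕜 W) (U : Submodule 𝕜 W) : Submodule 𝕜 W :=
  B.1.orthogonal U

end LinearAlgebra

/-! ### Complexified vector spaces: conjugation, real and imaginary parts, type (1,0) -/

section Complexification

variable {V : Type*} [AddCommGroup V] [Module ℝ V]

/-- Complex conjugation `a ⊗ v ↦ conj a ⊗ v` on the complexification of a real vector space. -/
def conjVec : ℂ ⊗[ℝ] V →ₗ[ℝ] ℂ ⊗[ℝ] V :=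
  LinearMap.rTensor V Complex.conjAe.toLinearMap

theorem conjVec_smul (a : ℂ) (v : ℂ ⊗[ℝ] V) :
    conjVec (a • v) = (starRingEnd ℂ) a • conjVec v := by
  induction v using TensorProduct.induction_on with
  | zero => simp
  | tmul z w => simp [conjVec, TensorProduct.smul_tmul']
  | add x y hx hy => rw [smul_add, map_add, hx, hy, map_add, smul_add]

/-- The conjugate `v ↦ conj (α (conj v))` of a complex covector `α`. -/
def conjCovec (α : Module.Dual ℂ (ℂ ⊗[ℝ] V)) : Module.Dual ℂ (ℂ ⊗[ℝ] V) where
  toFun v := (starRingEnd ℂ) (α (conjVec v))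
  map_add' u v := by simp
  map_smul' a v := by simp [conjVec_smul]

/-- The conjugate `(α, β) ↦ conj (b (conj α, conj β))` of a complex bivector `b`. -/
def conjBivector (b : Bivector ℂ (ℂ ⊗[ℝ] V)) : Bivector ℂ (ℂ ⊗[ℝ] V) :=
  ⟨LinearMap.mk₂ ℂ (fun α β => (starRingEnd ℂ) (b.1 (conjCovec α) (conjCovec β)))
    (fun α α' β => by
      have : conjCovec (α + α') = conjCovec α + conjCovec α' := by ext; simp [conjCovec]
      simp [this])
    (fun a α β => by
      have : conjCovec (a • α) = (starRingEnd ℂ) a • conjCovec α := by ext; simp [conjCovec]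
      simp [this])
    (fun α β β' => by
      have : conjCovec (β + β') = conjCovec β + conjCovec β' := by ext; simp [conjCovec]
      simp [this])
    (fun a α β => by
      have : conjCovec (a • β) = (starRingEnd ℂ) a • conjCovec β := by ext; simp [conjCovec]
      simp [this]),
   fun α => by
    have h := b.2 (conjCovec α)
    simp [h]⟩

/-- The real part of a complex bivector (as an element of the complexified exterior square). -/
def reBivector (b : Bivector ℂ (ℂ ⊗[ℝ] V)) : Bivector ℂ (ℂ ⊗[ℝ] V) :=
  (1 / 2 : ℂ) • (b + conjBivector b)

/-- The imaginary part of a complex bivector. -/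
def imBivector (b : Bivector ℂ (ℂ ⊗[ℝ] V)) : Bivector ℂ (ℂ ⊗[ℝ] V) :=
  (1 / (2 * Complex.I) : ℂ) • (b - conjBivector b)

/-- The bivector `λ₁ Re b + λ₂ Im b`. -/
def pencil (b : Bivector ℂ (ℂ ⊗[ℝ] V)) (l : ℂ × ℂ) : Bivector ℂ (ℂ ⊗[ℝ] V) :=
  l.1 • reBivector b + l.2 • imBivector b

/-- The (1,0)-part `V^{1,0} = {v - i J v}` of the complexification of a real vector space with
complex structure `J`: the `i`-eigenspace of the complexification of `J`. -/
def typeOneZero (J : V →ₗ[ℝ] V) : Submodule ℂ (ℂ ⊗[ℝ] V) :=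
  Module.End.eigenspace (J.baseChange ℂ) Complex.I

/-- The cross `Λ = Span{(1,i)} ∪ Span{(1,-i)}` in `ℂ²`. -/
def cross : Set (ℂ × ℂ) :=
  (Submodule.span ℂ {((1, Complex.I) : ℂ × ℂ)} : Set (ℂ × ℂ)) ∪
    (Submodule.span ℂ {((1, -Complex.I) : ℂ × ℂ)} : Set (ℂ × ℂ))

end Complexification

/-! ### Holomorphic symplectic manifolds

`M` is a complex manifold modelled on a finite-dimensional complex vector space `E`. The tangent
space at `x` is `E`, through the preferred chart at `x`; its underlying real vector space is the
tangent space of the underlying real manifold, and the complex structure is multiplication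
by `i`. -/

section Manifold

variable {E : Type*} [NormedAddCommGroup E] [NormedSpace ℂ E]
  {M : Type*} [TopologicalSpace M] [ChartedSpace E M]

variable (E M) in
/-- A holomorphic symplectic form: in every chart a closed holomorphic 2-form, nondegenerate at
every point. -/
structure HolomorphicSymplecticForm where
  /-- the value at a point, a complex bilinear alternating form on the tangent space -/
  toFun : ∀ x : M, TangentSpace 𝓘(ℂ, E) x [⋀^Fin 2]→L[ℂ] ℂ
  holomorphic : ∀ e ∈ atlas E M, DifferentiableOn ℂ
    (fun y : E => ((toFun (e.symm y)).compContinuousLinearMap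
      (mfderiv 𝓘(ℂ, E) 𝓘(ℂ, E) e.symm y) : E [⋀^Fin 2]→L[ℂ] ℂ)) e.target
  closed : ∀ e ∈ atlas E M, ∀ y ∈ e.target, extDeriv
    (fun y : E => ((toFun (e.symm y)).compContinuousLinearMap
      (mfderiv 𝓘(ℂ, E) 𝓘(ℂ, E) e.symm y) : E [⋀^Fin 2]→L[ℂ] ℂ)) y = 0
  nondegenerate : ∀ (x : M) (u : TangentSpace 𝓘(ℂ, E) x),
    (∀ v : TangentSpace 𝓘(ℂ, E) x, toFun x ![u, v] = 0) → u = 0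

variable (E) in
/-- The complex structure of the real tangent spaces. -/
def complexStructure : E →ₗ[ℝ] E where
  toFun v := Complex.I • v
  map_add' := smul_add _
  map_smul' _ _ := smul_comm _ _ _

/-- A complex bilinear alternating form `η` on `E` as a real bilinear map with complex values. -/
def realBilinear (η : E [⋀^Fin 2]→L[ℂ] ℂ) : E →ₗ[ℝ] E →ₗ[ℝ] ℂ :=
  have hup (u v w : E) : Function.update ![u, v] 1 w = ![u, w] := by
    ext i; fin_cases i <;> rfl
  LinearMap.mk₂ ℝ (fun u v => η ![u, v])
    (fun u u' v => η.toAlternatingMap.map_vecCons_add ![v] u u')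
    (fun a u v => by
      have h := η.toAlternatingMap.map_vecCons_smul ![v] (a : ℂ) u
      simpa using h)
    (fun u v v' => by
      have h := η.map_update_add ![u, v] 1 v v'
      rwa [hup, hup, hup] at h)
    (fun a u v => by
      have h := η.map_update_smul ![u, v] 1 (a : ℂ) v
      rw [hup, hup] at h
      simpa using h)

/-- The complex bilinear extension to `E^ℂ = ℂ ⊗ E` of a complex bilinear alternating form `η` on
`E`, that is, `(a ⊗ u, b ⊗ v) ↦ a b η(u, v)`: the 2-form of type (2,0) given by `η`. -/
def formExt (η : E [⋀^Fin 2]→L[ℂ] ℂ) : TwoForm ℂ (ℂ ⊗[ℝ] E) :=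
  ⟨LinearMap.liftBaseChange ℂ
      ((LinearMap.liftBaseChangeEquiv ℂ).toLinearMap.restrictScalars ℝ ∘ₗ realBilinear η), by
    set B := LinearMap.liftBaseChange ℂ
      ((LinearMap.liftBaseChangeEquiv ℂ).toLinearMap.restrictScalars ℝ ∘ₗ realBilinear η)
    have hη (u v : E) : η ![u, v] = -η ![v, u] := by
      have h := η.map_swap ![v, u] (show (0 : Fin 2) ≠ 1 by decide)
      have h' : ![v, u] ∘ Equiv.swap (0 : Fin 2) 1 = ![u, v] := by
        ext i; fin_cases i <;> rfl
      rwa [h'] at h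
    have hB (a b : ℂ) (u v : E) : B (a ⊗ₜ u) (b ⊗ₜ v) = a * b * η ![u, v] := by
      have h1 (g : E →ₗ[ℝ] ℂ) :
          LinearMap.liftBaseChangeEquiv ℂ g (b ⊗ₜ[ℝ] v) = b * g v :=
        LinearMap.liftBaseChange_tmul ℂ g b v
      have h2 : B (a ⊗ₜ u) = a • LinearMap.liftBaseChangeEquiv ℂ (realBilinear η u) :=
        LinearMap.liftBaseChange_tmul ℂ _ a u
      rw [h2, LinearMap.smul_apply, h1, smul_eq_mul, mul_assoc]
      rfl
    have hskew (x y : ℂ ⊗[ℝ] E) : B x y = -B y x := by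
      induction x using TensorProduct.induction_on with
      | zero => simp
      | tmul a u =>
        induction y using TensorProduct.induction_on with
        | zero => simp
        | tmul b v => rw [hB, hB, hη u v]; ring
        | add y y' hy hy' => simp [hy, hy']; ring
      | add x x' hx hx' => simp [hx, hx']; ring
    intro x
    have h := hskew x x
    linear_combination (1 / 2 : ℂ) * h⟩

namespace HolomorphicSymplecticForm

variable (Ω : HolomorphicSymplecticForm E M)

/-- The symplectic form at `x` as a 2-form of type (2,0) on the complexified tangent space. -/
def form (x : M) : TwoForm ℂ (ℂ ⊗[ℝ] E) := formExt (Ω.toFun x)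

/-- The holomorphic bivector `c = Ω⁻¹`: the inverse at each point of the restriction of `Ω` to
`T^{1,0} M`, considered as a complex bivector. -/
def bivector (x : M) : Bivector ℂ (ℂ ⊗[ℝ] E) :=
  Bivector.map (typeOneZero (complexStructure E)).subtype
    (TwoForm.inverse (TwoForm.comap (typeOneZero (complexStructure E)).subtype (Ω.form x)))

end HolomorphicSymplecticForm

/-! ### Submersions, leaves, projectable bivectors -/

variable {E' : Type*} [NormedAddCommGroup E'] [NormedSpace ℝ E']
  {M' : Type*} [TopologicalSpace M'] [ChartedSpace E' M']

/-- The differential at `x` of a map from `M`, as a real manifold, to `M'`. -/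
def realDiff (p : M → M') (x : M) : E →ₗ[ℝ] E' :=
  (mfderiv 𝓘(ℝ, E) 𝓘(ℝ, E') p x : E →L[ℝ] E').toLinearMap

variable (E E') in
/-- A smooth surjective submersion with connected fibres. -/
structure IsConnectedSubmersion (p : M → M') : Prop where
  smooth : ContMDiff 𝓘(ℝ, E) 𝓘(ℝ, E') ∞ p
  surjective : Function.Surjective p
  submersion : ∀ x, Function.Surjective (realDiff p x : E → E')
  connected : ∀ x', IsConnected (p ⁻¹' {x'})

variable (E E') in
/-- The tangent space at `x` of the leaf (fibre of `p`) through `x`. -/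
def leafTangent (p : M → M') (x : M) : Submodule ℝ E :=
  LinearMap.ker (realDiff p x : E →ₗ[ℝ] E')

variable (E E') in
/-- The complexified tangent space of the leaf through `x`. -/
def leafTangentC (p : M → M') (x : M) : Submodule ℂ (ℂ ⊗[ℝ] E) :=
  (leafTangent E E' p x).baseChange ℂ

variable (E E') in
/-- The (1,0)-tangent space `T^ℂ K ∩ T^{1,0} M` of the leaf through `x`. -/
def leafOneZero (p : M → M') (x : M) : Submodule ℂ (ℂ ⊗[ℝ] E) :=
  leafTangentC E E' p x ⊓ typeOneZero (complexStructure E)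

variable (E E') in
/-- The foliation by the fibres of `p` is a generic CR-foliation: along each leaf `L` the dimension
of `T^{1,0} L` is constant, and `TL + J TL = TM`. -/
structure IsGenericCRFoliation (p : M → M') : Prop where
  isCR : ∀ x y, p x = p y →
    Module.finrank ℂ (leafOneZero E E' p x) = Module.finrank ℂ (leafOneZero E E' p y)
  generic : ∀ x, leafTangent E E' p x ⊔ (leafTangent E E' p x).map (complexStructure E) = ⊤

variable (E') in
/-- The image of the bivector `Z x` under the second exterior power of the complexified
differential of `p` at `x`. -/
def pushAt (p : M → M') (Z : M → Bivector ℂ (ℂ ⊗[ℝ] E)) (x : M) : Bivector ℂ (ℂ ⊗[ℝ] E') :=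
  Bivector.map ((realDiff p x).baseChange ℂ) (Z x)

variable (E') in
/-- A (complex) bivector field `Z` is projectable along `p` if near each point its image in the
tangent spaces of `M'` depends only on the leaf. In local coordinates `(x, y)` adapted to `p`, with
`y` coming from `M'`, this says that `Z = Z'(y) + Z~(x,y)`, where `Z'(y)` is a bivector in the
`∂/∂y` whose coefficients depend on `y` only and each term of `Z~` contains some `∂/∂x`. -/
def IsProjectable (p : M → M') (Z : M → Bivector ℂ (ℂ ⊗[ℝ] E)) : Prop :=
  ∀ x : M, ∃ U ∈ 𝓝 x, ∀ u ∈ U, ∀ v ∈ U, p u = p v → pushAt E' p Z u = pushAt E' p Z v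

variable (E') in
open Classical in
/-- The push-forward of a projectable bivector field: its value at `x'` is the image of the value
at any point over `x'`. -/
def pushForward (p : M → M') (Z : M → Bivector ℂ (ℂ ⊗[ℝ] E)) (x' : M') :
    Bivector ℂ (ℂ ⊗[ℝ] E') :=
  if h : ∃ x, p x = x' then pushAt E' p Z h.choose else 0

/-- The push-forward is well defined for projectable fields and connected fibres. -/
theorem pushForward_apply {p : M → M'} (hp : IsConnectedSubmersion E E' p) {Z : M → Bivector ℂ (ℂ ⊗[ℝ] E)}
    (hZ : IsProjectable E' p Z) (x : M) : pushForward E' p Z (p x) = pushAt E' p Z x := by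
  have hconst (x' : M') (u v : M) (hu : p u = x') (hv : p v = x') :
      pushAt E' p Z u = pushAt E' p Z v := by
    have hpc : PreconnectedSpace (p ⁻¹' {x'}) :=
      Subtype.preconnectedSpace (hp.connected x').isPreconnected
    have hloc : IsLocallyConstant (fun w : p ⁻¹' {x'} => pushAt E' p Z w.1) := by
      rw [IsLocallyConstant.iff_eventually_eq]
      intro w
      obtain ⟨U, hU, h⟩ := hZ w.1
      filter_upwards [continuous_subtype_val.continuousAt.preimage_mem_nhds hU] with w' hw'
      exact h _ hw' _ (mem_of_mem_nhds hU) (w'.2.trans w.2.symm)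
    exact hloc.apply_eq_of_preconnectedSpace ⟨u, hu⟩ ⟨v, hv⟩
  have h : ∃ y, p y = p x := ⟨x, rfl⟩
  rw [pushForward, dif_pos h]
  exact hconst (p x) _ _ h.choose_spec rfl

/-! ### The pencils of bivectors, completeness, and the numbers `k` -/

/-- The real family spanned by the real and the imaginary part of a complex bivector field. -/
def pencilSpan (b : M' → Bivector ℂ (ℂ ⊗[ℝ] E')) :
    Submodule ℝ (M' → Bivector ℂ (ℂ ⊗[ℝ] E')) :=
  Submodule.span ℝ {fun y => reBivector (b y), fun y => imBivector (b y)}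

/-- The real and the imaginary part of `b` are linearly independent or both zero, so that they
generate a bihamiltonian structure, possibly the trivial one. -/
def IndepOrZero (b : M' → Bivector ℂ (ℂ ⊗[ℝ] E')) : Prop :=
  LinearIndependent ℝ ![fun y => reBivector (b y), fun y => imBivector (b y)] ∨
    ((fun y => reBivector (b y)) = 0 ∧ (fun y => imBivector (b y)) = 0)

variable [FiniteDimensional ℝ E']

/-- The maximal rank of the bivectors of a family, over all points. -/
def maxRank (J : Submodule ℝ (M' → Bivector ℂ (ℂ ⊗[ℝ] E'))) : ℕ :=
  sSup {r | ∃ b ∈ J, ∃ y, r = Bivector.rank (b y)}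

/-- A bihamiltonian structure `J` is complete at `x'` if at `x'` every nonzero member of its
complexification has the maximal rank attained by the members of `J` on the manifold. -/
def IsCompleteAt (J : Submodule ℝ (M' → Bivector ℂ (ℂ ⊗[ℝ] E'))) (x' : M') : Prop :=
  ∀ b ∈ Submodule.span ℂ (J : Set (M' → Bivector ℂ (ℂ ⊗[ℝ] E'))), b ≠ 0 →
    Bivector.rank (b x') = maxRank J

variable [FiniteDimensional ℂ E]

variable (E') in
/-- `k_λ` at `x`: the dimension of the intersection of `T^ℂ K` with its skew-orthogonal complement
with respect to `Ω_λ = (λ₁ Re c + λ₂ Im c)⁻¹`. -/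
def kLam (Ω : HolomorphicSymplecticForm E M) (p : M → M') (l : ℂ × ℂ) (x : M) : ℕ :=
  Module.finrank ℂ (leafTangentC E E' p x ⊓
    TwoForm.perp (Bivector.inverse (pencil (Ω.bivector x) l)) (leafTangentC E E' p x) :
      Submodule ℂ (ℂ ⊗[ℝ] E))

variable (E') in
/-- `k` at `x`: the dimension of the intersection of `T^{1,0} K` with its skew-orthogonal
complement in `T^{1,0} M` with respect to `Ω`. -/
def kHol (Ω : HolomorphicSymplecticForm E M) (p : M → M') (x : M) : ℕ :=
  Module.finrank ℂ (leafOneZero E E' p x ⊓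
    (typeOneZero (complexStructure E) ⊓ TwoForm.perp (Ω.form x) (leafOneZero E E' p x)) :
      Submodule ℂ (ℂ ⊗[ℝ] E))

end Manifold

end SymplecticReduction

end

open SymplecticReduction

/-! Everything rests on one fact of symplectic linear algebra, `finrank_ker_inf_perp`. Let `b` be
inverse to a nondegenerate form `B` on `W`, and let `f : W → W'` be onto with kernel `K`. Then `α ↦
B⁻¹(α ∘ f)` identifies the dual of `W'` with `K^⊥`. Under this identification the kernel of the
pushed-forward bivector becomes `K ∩ K^⊥`, so its corank is `dim (K ∩ K^⊥)`.

For claim 1 take `W = T^ℂ M`, `f = p_*` and `b = c_λ`. Nondegeneracy of `c_λ` off the cross comes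
from `c_λ = ((λ₁ - iλ₂)/2) c + ((λ₁ + iλ₂)/2) c̄`, whose two terms live on complementary blocks
(`pencil_sharp_bijective`). For claim 2 take `W = T^{1,0} M` and `b = ω⁻¹`. Genericity of the
foliation makes `p_*` onto already on `T^{1,0} M` (`surjective_oneZero`), and conjugation preserves
ranks.

Claim 3 is then a statement about the coranks of the pencil of `c'` (`forall_rank_eq_reImSpan_iff`).
On the cross, away from 0, the pencil consists of multiples of `c'` and `c̄'`, so its rank is
governed by `k`; off the cross it is governed by `k_λ`. The maximal rank is defined through real
members only, but it bounds the complex members too, since the rank at a complex parameter is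
reached or exceeded at a real one (`exists_real_finrank_range_le`). -/

noncomputable section

namespace SymplecticReduction

/-! ### Inverse forms and bivectors, coranks and push-forward. -/

section LinearAlgebra

variable {𝕜 W W' : Type*} [Field 𝕜] [AddCommGroup W] [Module 𝕜 W]
  [AddCommGroup W'] [Module 𝕜 W']

theorem TwoForm.apply_swap (B : TwoForm 𝕜 W) (u v : W) : B.1 u v = -B.1 v u :=
  (LinearMap.IsAlt.neg B.2 v u).symm

theorem Bivector.map_apply (f : W →ₗ[𝕜] W') (b : Bivector 𝕜 W) (α β : Module.Dual 𝕜 W') :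
    (Bivector.map f b).1 α β = b.1 (α ∘ₗ f) (β ∘ₗ f) := rfl

theorem Bivector.map_map {W'' : Type*} [AddCommGroup W''] [Module 𝕜 W''] (g : W' →ₗ[𝕜] W'')
    (f : W →ₗ[𝕜] W') (b : Bivector 𝕜 W) :
    Bivector.map g (Bivector.map f b) = Bivector.map (g ∘ₗ f) b := rfl

theorem Bivector.apply_sharp [FiniteDimensional 𝕜 W] (b : Bivector 𝕜 W)
    (α β : Module.Dual 𝕜 W) : β (Bivector.sharp b α) = b.1 α β := by
  simp [Bivector.sharp]

theorem Bivector.rank_eq [FiniteDimensional 𝕜 W] (b : Bivector 𝕜 W) :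
    Bivector.rank b = Module.finrank 𝕜 (LinearMap.range b.1) := by
  rw [Bivector.rank, Bivector.charSubspace, Bivector.sharp,
    LinearMap.range_comp]
  exact LinearEquiv.finrank_map_eq _ _

theorem Bivector.rank_add_codimChar [FiniteDimensional 𝕜 W] (b : Bivector 𝕜 W) :
    Bivector.rank b + Bivector.codimChar b = Module.finrank 𝕜 W := by
  rw [add_comm]
  exact Submodule.finrank_quotient_add_finrank _

/-- `W` and its dual have equal dimension, so corank and nullity agree; coranks are computed in this
form below. -/
theorem Bivector.codimChar_eq [FiniteDimensional 𝕜 W] (b : Bivector 𝕜 W) :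
    Bivector.codimChar b = Module.finrank 𝕜 (LinearMap.ker b.1) := by
  have h1 := Bivector.rank_add_codimChar b
  have h2 := LinearMap.finrank_range_add_finrank_ker b.1
  rw [Bivector.rank_eq] at h1
  rw [Subspace.dual_finrank_eq] at h2
  omega

/-- If `b` is inverse to the nondegenerate 2-form `B`, the characteristic subspace of the image of
`b` under a surjection `f` has codimension `dim (ker f ∩ (ker f)^⊥)`. -/
theorem finrank_ker_inf_perp [FiniteDimensional 𝕜 W] [FiniteDimensional 𝕜 W']
    (B : TwoForm 𝕜 W) (hB : Function.Bijective B.1) (b : Bivector 𝕜 W)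
    (hb : ∀ u v, b.1 (B.1 u) (B.1 v) = B.1 u v) (f : W →ₗ[𝕜] W') (hf : Function.Surjective f) :
    Module.finrank 𝕜 (LinearMap.ker f ⊓ TwoForm.perp B (LinearMap.ker f) : Submodule 𝕜 W) =
      Bivector.codimChar (Bivector.map f b) := by
  set e := LinearEquiv.ofBijective B.1 hB
  have he (α : Module.Dual 𝕜 W) : B.1 (e.symm α) = α := e.apply_symm_apply α
  have hinj : Function.Injective (e.symm.toLinearMap ∘ₗ f.dualMap) :=
    e.symm.injective.comp (LinearMap.dualMap_injective_of_surjective hf)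
  rw [Bivector.codimChar_eq, (Submodule.equivMapOfInjective _ hinj _).finrank_eq]
  -- A vector `u` is orthogonal to `ker f` exactly when the covector `B u` kills `ker f`, that is,
  -- when it factors as `α ∘ f`. It lies in `ker f` exactly when this `α` is in the kernel of the
  -- image bivector, by `key`.
  suffices h : LinearMap.ker f ⊓ TwoForm.perp B (LinearMap.ker f) =
      (LinearMap.ker (Bivector.map f b).1).map (e.symm.toLinearMap ∘ₗ f.dualMap) by rw [h]
  ext u
  have key (α : Module.Dual 𝕜 W') : (Bivector.map f b).1 α = 0 ↔
      f (e.symm (α ∘ₗ f)) = 0 := by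
    have h (β : Module.Dual 𝕜 W') :
        (Bivector.map f b).1 α β = - β (f (e.symm (α ∘ₗ f))) := by
      rw [Bivector.map_apply, ← he (α ∘ₗ f), ← he (β ∘ₗ f), hb, TwoForm.apply_swap, he, he]
      rfl
    rw [LinearMap.ext_iff, ← Module.forall_dual_apply_eq_zero_iff 𝕜]
    simp [h]
  simp only [Submodule.mem_inf, Submodule.mem_map, LinearMap.mem_ker, key]
  constructor
  · rintro ⟨hu, hp⟩
    have hp' : B.1 u ∈ (LinearMap.ker f).dualAnnihilator := by
      rw [Submodule.mem_dualAnnihilator]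
      intro v hv
      rw [TwoForm.apply_swap, neg_eq_zero]
      exact hp v hv
    rw [← LinearMap.range_dualMap_eq_dualAnnihilator_ker] at hp'
    obtain ⟨α, hα⟩ := hp'
    have : e.symm (α ∘ₗ f) = u := by
      rw [LinearEquiv.symm_apply_eq]
      exact hα
    exact ⟨α, by rw [this, hu], this⟩
  · rintro ⟨α, hα, rfl⟩
    refine ⟨hα, fun v hv => ?_⟩
    change B.1 v (e.symm (α ∘ₗ f)) = 0
    rw [TwoForm.apply_swap, he]
    simp [LinearMap.mem_ker.1 hv]

theorem TwoForm.inverse_apply (B : TwoForm 𝕜 W) (hB : Function.Bijective B.1) (u v : W) :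
    (TwoForm.inverse B).1 (B.1 u) (B.1 v) = B.1 u v := by
  have h (w : W) : (LinearEquiv.ofBijective B.1 hB).symm (B.1 w) = w :=
    (LinearEquiv.ofBijective B.1 hB).symm_apply_apply w
  rw [TwoForm.inverse, dif_pos hB]
  simp [TwoForm.comap, h]

theorem Bivector.sharp_bijective [FiniteDimensional 𝕜 W] (b : Bivector 𝕜 W)
    (h : ∀ α, (∀ β, b.1 α β = 0) → α = 0) : Function.Bijective (Bivector.sharp b) := by
  have hinj : Function.Injective (Bivector.sharp b) := by
    rw [← LinearMap.ker_eq_bot, LinearMap.ker_eq_bot']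
    intro α hα
    exact h α fun β => by rw [← Bivector.apply_sharp, hα, map_zero]
  exact ⟨hinj, (LinearMap.injective_iff_surjective_of_finrank_eq_finrank
    Subspace.dual_finrank_eq).1 hinj⟩

theorem Bivector.inverse_apply_sharp [FiniteDimensional 𝕜 W] (b : Bivector 𝕜 W)
    (hb : Function.Bijective (Bivector.sharp b)) (α β : Module.Dual 𝕜 W) :
    (Bivector.inverse b).1 (Bivector.sharp b α) (Bivector.sharp b β) = b.1 α β := by
  have h (γ : Module.Dual 𝕜 W) :
      (LinearEquiv.ofBijective (Bivector.sharp b) hb).symm (Bivector.sharp b γ) = γ :=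
    (LinearEquiv.ofBijective (Bivector.sharp b) hb).symm_apply_apply γ
  rw [Bivector.inverse, dif_pos hb]
  simp [TwoForm.comap, h]

/-- The sign appears because the sharp map fills the first slot of `b`. It cancels in
`apply_inverse`, where the form enters twice. -/
theorem Bivector.inverse_sharp [FiniteDimensional 𝕜 W] (b : Bivector 𝕜 W)
    (hb : Function.Bijective (Bivector.sharp b)) (α : Module.Dual 𝕜 W) :
    (Bivector.inverse b).1 (Bivector.sharp b α) = -α := by
  ext v
  obtain ⟨β, rfl⟩ := hb.2 v
  rw [Bivector.inverse_apply_sharp b hb, TwoForm.apply_swap, ← Bivector.apply_sharp]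
  rfl

theorem Bivector.inverse_bijective [FiniteDimensional 𝕜 W] (b : Bivector 𝕜 W)
    (hb : Function.Bijective (Bivector.sharp b)) : Function.Bijective (Bivector.inverse b).1 := by
  constructor
  · intro u v huv
    obtain ⟨α, rfl⟩ := hb.2 u
    obtain ⟨β, rfl⟩ := hb.2 v
    rw [Bivector.inverse_sharp b hb, Bivector.inverse_sharp b hb, neg_inj] at huv
    rw [huv]
  · intro α
    exact ⟨Bivector.sharp b (-α), by rw [Bivector.inverse_sharp b hb, neg_neg]⟩

theorem Bivector.apply_inverse [FiniteDimensional 𝕜 W] (b : Bivector 𝕜 W)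
    (hb : Function.Bijective (Bivector.sharp b)) (u v : W) :
    b.1 ((Bivector.inverse b).1 u) ((Bivector.inverse b).1 v) = (Bivector.inverse b).1 u v := by
  obtain ⟨α, rfl⟩ := hb.2 u
  obtain ⟨β, rfl⟩ := hb.2 v
  rw [Bivector.inverse_apply_sharp b hb, Bivector.inverse_sharp b hb, Bivector.inverse_sharp b hb]
  simp

theorem Bivector.rank_smul [FiniteDimensional 𝕜 W] {a : 𝕜} (ha : a ≠ 0) (b : Bivector 𝕜 W) :
    Bivector.rank (a • b) = Bivector.rank b := by
  rw [Bivector.rank_eq, Bivector.rank_eq]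
  change Module.finrank 𝕜 (LinearMap.range (a • b.1)) = _
  rw [LinearMap.range_smul _ _ ha]

theorem Bivector.rank_zero [FiniteDimensional 𝕜 W] : Bivector.rank (0 : Bivector 𝕜 W) = 0 := by
  rw [Bivector.rank_eq]
  exact (congrArg (fun S : Submodule 𝕜 _ => Module.finrank 𝕜 S) LinearMap.range_zero).trans
    (finrank_bot 𝕜 _)

theorem Bivector.rank_le [FiniteDimensional 𝕜 W] (b : Bivector 𝕜 W) :
    Bivector.rank b ≤ Module.finrank 𝕜 W :=
  Submodule.finrank_le _

end LinearAlgebra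

/-! ### Kernels under base change, and the generic rank in a pencil of linear maps. -/

/-- Right exactness of the tensor product, applied to `ker f → V → V' → 0`; surjectivity of `f`
takes the place of flatness. -/
theorem ker_baseChange_eq {R A V V' : Type*} [CommRing R] [CommRing A] [Algebra R A]
    [AddCommGroup V] [Module R V] [AddCommGroup V'] [Module R V'] (f : V →ₗ[R] V')
    (hf : Function.Surjective f) :
    LinearMap.ker (f.baseChange A) = (LinearMap.ker f).baseChange A := by
  have h := lTensor_exact A (LinearMap.exact_subtype_ker_map f) hf
  ext w
  exact h w

/-- Along a pencil of complex linear maps the rank at a complex point is attained or exceeded at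
some real point. -/
theorem exists_real_finrank_range_le {X Y : Type*} [AddCommGroup X] [Module ℂ X]
    [AddCommGroup Y] [Module ℂ Y] [FiniteDimensional ℂ X] [FiniteDimensional ℂ Y]
    (f g : X →ₗ[ℂ] Y) (z : ℂ) :
    ∃ t : ℝ, Module.finrank ℂ (LinearMap.range (f + z • g)) ≤
      Module.finrank ℂ (LinearMap.range (f + (t : ℂ) • g)) := by
  set h := f + z • g with hh
  set r := Module.finrank ℂ (LinearMap.range h)
  let e := (Module.finBasis ℂ (LinearMap.range h)).equivFun
  obtain ⟨s, hs⟩ := h.rangeRestrict.exists_rightInverse_of_surjective h.range_rangeRestrict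
  obtain ⟨π, hπ⟩ := (LinearMap.range h).subtype.exists_leftInverse_of_injective
    (LinearMap.range h).ker_subtype
  -- Compressing by `i` and `q` turns `h` into the identity of `ℂ^r`. Hence `det (q ∘ (f + w g) ∘
  -- i)` is a polynomial in `w` equal to 1 at `z`. It has finitely many roots, and any real non-root
  -- `t` gives rank at least `r`.
  let i : (Fin r → ℂ) →ₗ[ℂ] X := s ∘ₗ e.symm.toLinearMap
  let q : Y →ₗ[ℂ] (Fin r → ℂ) := e.toLinearMap ∘ₗ π
  have hid : q ∘ₗ h ∘ₗ i = LinearMap.id := by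
    refine LinearMap.ext fun x => ?_
    have h1 : h (s (e.symm x)) = e.symm x :=
      congrArg Subtype.val (LinearMap.congr_fun hs (e.symm x))
    have h2 := LinearMap.congr_fun hπ (e.symm x)
    simp only [LinearMap.comp_apply, Submodule.subtype_apply, LinearMap.id_apply] at h2
    simp [q, i, h1, h2]
  let F := LinearMap.toMatrix' (q ∘ₗ f ∘ₗ i)
  let G := LinearMap.toMatrix' (q ∘ₗ g ∘ₗ i)
  let P : Polynomial ℂ := (F.map Polynomial.C +
    Matrix.of fun a b => Polynomial.X * Polynomial.C (G a b)).det
  have hP (w : ℂ) : P.eval w = LinearMap.det (q ∘ₗ (f + w • g) ∘ₗ i) := by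
    rw [← LinearMap.det_toMatrix', ← Polynomial.coe_evalRingHom, RingHom.map_det]
    congr 1
    have : q ∘ₗ (f + w • g) ∘ₗ i = q ∘ₗ f ∘ₗ i + w • (q ∘ₗ g ∘ₗ i) := by
      ext; simp
    rw [this]
    ext a b
    simp [F, G]
    ring
  have hP0 : P ≠ 0 := by
    intro h0
    have := hP z
    rw [← hh, hid, h0] at this
    simp at this
  have hfin : {w : ℂ | P.IsRoot w}.Finite := Polynomial.finite_setOfPred_isRoot hP0
  have hinf : (Set.range ((↑) : ℝ → ℂ)).Infinite :=
    Set.infinite_range_of_injective Complex.ofReal_injective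
  obtain ⟨_, ⟨t, rfl⟩, ht⟩ := hinf.exists_notMem_finite hfin
  refine ⟨t, ?_⟩
  have hu : IsUnit (LinearMap.det (q ∘ₗ (f + (t : ℂ) • g) ∘ₗ i)) := by
    rw [← hP, isUnit_iff_ne_zero]
    exact ht
  have hbij := (LinearMap.isUnit_iff_isUnit_det _).2 hu
  have hsurj : LinearMap.range (q ∘ₗ (f + (t : ℂ) • g) ∘ₗ i) = ⊤ :=
    LinearMap.range_eq_top.2 ((Module.End.isUnit_iff _).1 hbij).2
  calc r = Module.finrank ℂ (LinearMap.range (q ∘ₗ (f + (t : ℂ) • g) ∘ₗ i)) := by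
        rw [hsurj, finrank_top]; simp
    _ ≤ Module.finrank ℂ ((LinearMap.range (f + (t : ℂ) • g)).map q) := by
        apply Submodule.finrank_mono
        rw [LinearMap.range_comp]
        exact Submodule.map_mono (LinearMap.range_comp_le_range _ _)
    _ ≤ _ := Submodule.finrank_map_le _ _

/-! ### Complex conjugation, the pencil and the cross. -/

section Complexification

variable {V V' : Type*} [AddCommGroup V] [Module ℝ V] [AddCommGroup V'] [Module ℝ V']

theorem conjVec_conjVec (v : ℂ ⊗[ℝ] V) : conjVec (conjVec v) = v := by
  induction v using TensorProduct.induction_on with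
  | zero => simp
  | tmul z w => simp [conjVec]
  | add x y hx hy => rw [map_add, map_add, hx, hy]

theorem conjVec_baseChange (f : V →ₗ[ℝ] V') (v : ℂ ⊗[ℝ] V) :
    conjVec (f.baseChange ℂ v) = f.baseChange ℂ (conjVec v) := by
  induction v using TensorProduct.induction_on with
  | zero => simp
  | tmul z w => simp [conjVec]
  | add x y hx hy => simp only [map_add, hx, hy]

theorem conjCovec_apply (α : Module.Dual ℂ (ℂ ⊗[ℝ] V)) (v : ℂ ⊗[ℝ] V) :
    conjCovec α v = (starRingEnd ℂ) (α (conjVec v)) := rfl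

theorem conjCovec_conjCovec (α : Module.Dual ℂ (ℂ ⊗[ℝ] V)) : conjCovec (conjCovec α) = α := by
  refine LinearMap.ext fun v => ?_
  rw [conjCovec_apply, conjCovec_apply, conjVec_conjVec, Complex.conj_conj]

theorem conjCovec_add (α β : Module.Dual ℂ (ℂ ⊗[ℝ] V)) :
    conjCovec (α + β) = conjCovec α + conjCovec β := by
  ext; simp [conjCovec]

theorem conjCovec_smul (a : ℂ) (α : Module.Dual ℂ (ℂ ⊗[ℝ] V)) :
    conjCovec (a • α) = (starRingEnd ℂ) a • conjCovec α := by
  ext; simp [conjCovec]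

theorem conjCovec_comp_baseChange (f : V →ₗ[ℝ] V') (α : Module.Dual ℂ (ℂ ⊗[ℝ] V')) :
    conjCovec (α ∘ₗ f.baseChange ℂ) = conjCovec α ∘ₗ f.baseChange ℂ := by
  refine LinearMap.ext fun v => ?_
  simp only [conjCovec_apply, LinearMap.comp_apply, conjVec_baseChange]

theorem conjBivector_apply (b : Bivector ℂ (ℂ ⊗[ℝ] V)) (α β : Module.Dual ℂ (ℂ ⊗[ℝ] V)) :
    (conjBivector b).1 α β = (starRingEnd ℂ) (b.1 (conjCovec α) (conjCovec β)) := rfl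

theorem Bivector.ext {b b' : Bivector ℂ (ℂ ⊗[ℝ] V)} (h : ∀ α β, b.1 α β = b'.1 α β) : b = b' :=
  Subtype.ext (LinearMap.ext₂ h)

theorem conjBivector_conjBivector (b : Bivector ℂ (ℂ ⊗[ℝ] V)) :
    conjBivector (conjBivector b) = b :=
  Bivector.ext fun α β => by simp [conjBivector_apply, conjCovec_conjCovec]

theorem conjBivector_add (b b' : Bivector ℂ (ℂ ⊗[ℝ] V)) :
    conjBivector (b + b') = conjBivector b + conjBivector b' :=
  Bivector.ext fun α β => by simp [conjBivector_apply]

theorem conjBivector_sub (b b' : Bivector ℂ (ℂ ⊗[ℝ] V)) :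
    conjBivector (b - b') = conjBivector b - conjBivector b' :=
  Bivector.ext fun α β => by simp [conjBivector_apply]

theorem conjBivector_smul (a : ℂ) (b : Bivector ℂ (ℂ ⊗[ℝ] V)) :
    conjBivector (a • b) = (starRingEnd ℂ) a • conjBivector b :=
  Bivector.ext fun α β => by simp [conjBivector_apply]

theorem conjBivector_zero : conjBivector (0 : Bivector ℂ (ℂ ⊗[ℝ] V)) = 0 :=
  Bivector.ext fun α β => by simp [conjBivector_apply]

theorem conjBivector_reBivector (b : Bivector ℂ (ℂ ⊗[ℝ] V)) :
    conjBivector (reBivector b) = reBivector b := by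
  rw [reBivector, conjBivector_smul, conjBivector_add, conjBivector_conjBivector, add_comm]
  simp only [map_div₀, map_one, map_ofNat]

theorem conjBivector_imBivector (b : Bivector ℂ (ℂ ⊗[ℝ] V)) :
    conjBivector (imBivector b) = imBivector b := by
  rw [imBivector, conjBivector_smul, conjBivector_sub, conjBivector_conjBivector]
  simp only [map_div₀, map_one, map_mul, map_ofNat, Complex.conj_I, mul_neg, div_neg]
  module

theorem conjBivector_map_baseChange (f : V →ₗ[ℝ] V') (b : Bivector ℂ (ℂ ⊗[ℝ] V)) :
    conjBivector (Bivector.map (f.baseChange ℂ) b) =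
      Bivector.map (f.baseChange ℂ) (conjBivector b) :=
  Bivector.ext fun α β => by
    simp only [conjBivector_apply, Bivector.map_apply, conjCovec_comp_baseChange]

/-- The pencil in terms of a bivector and its conjugate. -/
theorem pencil_eq (b : Bivector ℂ (ℂ ⊗[ℝ] V)) (l : ℂ × ℂ) :
    pencil b l = ((l.1 - Complex.I * l.2) / 2) • b +
      ((l.1 + Complex.I * l.2) / 2) • conjBivector b := by
  have h : (1 / (2 * Complex.I) : ℂ) = -Complex.I / 2 := by
    rw [div_eq_div_iff (by simp) (by simp)]
    linear_combination (2 : ℂ) * Complex.I_mul_I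
  rw [pencil, reBivector, imBivector, h]
  module

theorem pencil_map_baseChange (f : V →ₗ[ℝ] V') (b : Bivector ℂ (ℂ ⊗[ℝ] V)) (l : ℂ × ℂ) :
    pencil (Bivector.map (f.baseChange ℂ) b) l = Bivector.map (f.baseChange ℂ) (pencil b l) := by
  rw [pencil_eq, pencil_eq, conjBivector_map_baseChange]
  exact Bivector.ext fun α β => by simp [Bivector.map_apply]

/-- The two lines of the cross are the zero sets of the two coefficients in `pencil_eq`. -/
theorem mem_cross_iff (l : ℂ × ℂ) :
    l ∈ cross ↔ l.1 + Complex.I * l.2 = 0 ∨ l.1 - Complex.I * l.2 = 0 := by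
  obtain ⟨a, b⟩ := l
  simp only [cross, Set.mem_union, SetLike.mem_coe, Submodule.mem_span_singleton, Prod.smul_mk,
    Prod.mk.injEq, smul_eq_mul, mul_one, exists_eq_left]
  refine or_congr ⟨?_, ?_⟩ ⟨?_, ?_⟩ <;> intro h
  · linear_combination (-Complex.I) * h + a * Complex.I_mul_I
  · linear_combination Complex.I * h - b * Complex.I_mul_I
  · linear_combination Complex.I * h + a * Complex.I_mul_I
  · linear_combination (-Complex.I) * h - b * Complex.I_mul_I

/-- Conjugation of covectors is a conjugate-linear bijection between the two kernels, and semilinear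
bijections preserve dimension. -/
theorem codimChar_conjBivector [FiniteDimensional ℝ V] (b : Bivector ℂ (ℂ ⊗[ℝ] V)) :
    Bivector.codimChar (conjBivector b) = Bivector.codimChar b := by
  have hmem (b : Bivector ℂ (ℂ ⊗[ℝ] V)) (α : Module.Dual ℂ (ℂ ⊗[ℝ] V))
      (hα : α ∈ LinearMap.ker b.1) : conjCovec α ∈ LinearMap.ker (conjBivector b).1 := by
    rw [LinearMap.mem_ker] at hα ⊢
    refine LinearMap.ext fun β => ?_
    rw [conjBivector_apply, conjCovec_conjCovec, hα]
    simp
  have hmem' (α : Module.Dual ℂ (ℂ ⊗[ℝ] V))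
      (hα : α ∈ LinearMap.ker (conjBivector b).1) : conjCovec α ∈ LinearMap.ker b.1 := by
    have h := hmem _ α hα
    rwa [conjBivector_conjBivector] at h
  let j : LinearMap.ker (conjBivector b).1 ≃+ LinearMap.ker b.1 :=
    { toFun := fun α => ⟨conjCovec α.1, hmem' _ α.2⟩
      invFun := fun α => ⟨conjCovec α.1, hmem _ _ α.2⟩
      left_inv := fun α => Subtype.ext (conjCovec_conjCovec _)
      right_inv := fun α => Subtype.ext (conjCovec_conjCovec _)
      map_add' := fun α β => Subtype.ext (conjCovec_add _ _) }
  rw [Bivector.codimChar_eq, Bivector.codimChar_eq, Module.finrank, Module.finrank,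
    rank_eq_of_equiv_equiv (starRingEnd ℂ) j (starRingAut (R := ℂ)).bijective ?_]
  exact fun r α => Subtype.ext (conjCovec_smul _ _)

/-! ### The (1,0)-part and its projection -/

variable (J : V →ₗ[ℝ] V)

theorem mem_typeOneZero {t : ℂ ⊗[ℝ] V} :
    t ∈ typeOneZero J ↔ J.baseChange ℂ t = Complex.I • t :=
  Module.End.mem_eigenspace_iff

variable {J}

theorem baseChange_baseChange_of_sq (hJ : ∀ v, J (J v) = -v) (t : ℂ ⊗[ℝ] V) :
    J.baseChange ℂ (J.baseChange ℂ t) = -t := by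
  induction t using TensorProduct.induction_on with
  | zero => simp
  | tmul z w => simp [hJ, TensorProduct.tmul_neg]
  | add x y hx hy => rw [map_add, map_add, hx, hy, neg_add]

/-- The projection of the complexification onto its (1,0)-part. -/
def projOneZero (hJ : ∀ v, J (J v) = -v) : ℂ ⊗[ℝ] V →ₗ[ℂ] typeOneZero J :=
  LinearMap.codRestrict (typeOneZero J)
    ((1 / 2 : ℂ) • (LinearMap.id - Complex.I • J.baseChange ℂ)) fun t => by
      rw [mem_typeOneZero]
      simp only [LinearMap.smul_apply, LinearMap.sub_apply, LinearMap.id_apply, map_smul, map_sub,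
        baseChange_baseChange_of_sq hJ]
      rw [smul_comm Complex.I, smul_sub Complex.I, smul_smul Complex.I Complex.I, Complex.I_mul_I]
      congr 1
      module

theorem projOneZero_apply (hJ : ∀ v, J (J v) = -v) (t : ℂ ⊗[ℝ] V) :
    (projOneZero hJ t : ℂ ⊗[ℝ] V) = (1 / 2 : ℂ) • (t - Complex.I • J.baseChange ℂ t) := rfl

theorem projOneZero_coe (hJ : ∀ v, J (J v) = -v) (t : typeOneZero J) :
    projOneZero hJ (t : ℂ ⊗[ℝ] V) = t := by
  refine Subtype.ext ?_
  rw [projOneZero_apply, (mem_typeOneZero J).1 t.2, smul_smul, Complex.I_mul_I]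
  module

theorem projOneZero_conjVec (hJ : ∀ v, J (J v) = -v) (t : typeOneZero J) :
    projOneZero hJ (conjVec (t : ℂ ⊗[ℝ] V)) = 0 := by
  refine Subtype.ext ?_
  rw [projOneZero_apply, ← conjVec_baseChange, (mem_typeOneZero J).1 t.2, conjVec_smul, smul_smul,
    Complex.conj_I, mul_neg, Complex.I_mul_I]
  simp

/-- Every vector is the sum of its (1,0)-part and the conjugate of the (1,0)-part of its
conjugate. -/
theorem projOneZero_add_conj (hJ : ∀ v, J (J v) = -v) (t : ℂ ⊗[ℝ] V) :
    (projOneZero hJ t : ℂ ⊗[ℝ] V) + conjVec (projOneZero hJ (conjVec t) : ℂ ⊗[ℝ] V) = t := by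
  rw [projOneZero_apply, projOneZero_apply, conjVec_smul, map_sub, conjVec_smul,
    conjVec_baseChange, conjVec_conjVec, Complex.conj_I]
  simp only [map_div₀, map_one, map_ofNat]
  module

theorem tmul_sub_mem_typeOneZero (hJ : ∀ v, J (J v) = -v) (w : V) :
    (1 : ℂ) ⊗ₜ[ℝ] w - Complex.I ⊗ₜ[ℝ] J w ∈ typeOneZero J := by
  rw [mem_typeOneZero]
  simp [hJ, smul_sub, TensorProduct.smul_tmul', TensorProduct.tmul_neg, TensorProduct.neg_tmul]
  abel

theorem exists_tmul_sub_eq (hJ : ∀ v, J (J v) = -v) (t : typeOneZero J) :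
    ∃ w : V, (t : ℂ ⊗[ℝ] V) = (1 : ℂ) ⊗ₜ[ℝ] w - Complex.I ⊗ₜ[ℝ] J w := by
  suffices h : ∀ s : ℂ ⊗[ℝ] V, ∃ w : V,
      s - Complex.I • J.baseChange ℂ s = (1 : ℂ) ⊗ₜ[ℝ] w - Complex.I ⊗ₜ[ℝ] J w by
    obtain ⟨w, hw⟩ := h ((1 / 2 : ℂ) • (t : ℂ ⊗[ℝ] V))
    refine ⟨w, ?_⟩
    rw [← hw, map_smul, smul_comm Complex.I, ← smul_sub, ← projOneZero_apply hJ,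
      projOneZero_coe]
  intro s
  induction s using TensorProduct.induction_on with
  | zero => exact ⟨0, by simp⟩
  | tmul z v =>
    -- On the image of `1 - iJ` multiplication by `i` is `J`: `(1 - iJ)(iv) = (1 - iJ)(Jv)`.
    refine ⟨z.re • v + z.im • J v, ?_⟩
    have hz : z ⊗ₜ[ℝ] v = (1 : ℂ) ⊗ₜ[ℝ] (z.re • v) + Complex.I ⊗ₜ[ℝ] (z.im • v) := by
      rw [← TensorProduct.smul_tmul, ← TensorProduct.smul_tmul, ← TensorProduct.add_tmul]
      congr 1
      simpa [mul_comm] using (Complex.re_add_im z).symm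
    rw [hz]
    simp [hJ, smul_add, TensorProduct.smul_tmul', TensorProduct.tmul_neg, TensorProduct.neg_tmul,
      TensorProduct.tmul_add, -TensorProduct.tmul_smul]
    abel
  | add x y hx hy =>
    obtain ⟨w, hw⟩ := hx
    obtain ⟨w', hw'⟩ := hy
    refine ⟨w + w', ?_⟩
    rw [map_add, smul_add, map_add, TensorProduct.tmul_add, TensorProduct.tmul_add,
      add_sub_add_comm, hw, hw', add_sub_add_comm]

/-- If a bivector comes from a nondegenerate bivector on the (1,0)-part, its pencil is
nondegenerate outside the cross. -/
theorem pencil_sharp_bijective [FiniteDimensional ℝ V] (hJ : ∀ v, J (J v) = -v)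
    (c : Bivector ℂ (typeOneZero J)) (hc : ∀ γ, (∀ δ, c.1 γ δ = 0) → γ = 0) {l : ℂ × ℂ}
    (hl : l ∉ cross) :
    Function.Bijective
      (Bivector.sharp (pencil (Bivector.map (typeOneZero J).subtype c) l)) := by
  rw [mem_cross_iff, not_or] at hl
  refine Bivector.sharp_bijective _ fun α hα => ?_
  set ι := (typeOneZero J).subtype
  have hα' (β : Module.Dual ℂ (ℂ ⊗[ℝ] V)) :
      (l.1 - Complex.I * l.2) / 2 * c.1 (α ∘ₗ ι) (β ∘ₗ ι) + (l.1 + Complex.I * l.2) / 2 *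
        (starRingEnd ℂ) (c.1 (conjCovec α ∘ₗ ι) (conjCovec β ∘ₗ ι)) = 0 := by
    have h := hα β
    rw [pencil_eq] at h
    exact h
  have hpi : ∀ γ : Module.Dual ℂ (typeOneZero J), (γ ∘ₗ projOneZero hJ) ∘ₗ ι = γ := fun γ =>
    LinearMap.ext fun t => by simp [ι, projOneZero_coe]
  have hpi' : ∀ γ : Module.Dual ℂ (typeOneZero J), conjCovec (γ ∘ₗ projOneZero hJ) ∘ₗ ι = 0 :=
    fun γ => LinearMap.ext fun t => by simp [ι, conjCovec_apply, projOneZero_conjVec]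
  -- Testing against `γ ∘ projOneZero` kills the conjugate term, and testing against its conjugate
  -- kills the other one. Each remaining coefficient is nonzero off the cross, so `α` vanishes on
  -- the (1,0)-part and on its conjugate.
  have h1 : α ∘ₗ ι = 0 := hc _ fun γ => by
    have h := hα' (γ ∘ₗ projOneZero hJ)
    rw [hpi, hpi', map_zero, map_zero, mul_zero, add_zero] at h
    exact (mul_eq_zero.1 h).resolve_left (div_ne_zero hl.2 two_ne_zero)
  have h2 : conjCovec α ∘ₗ ι = 0 := hc _ fun γ => by
    have h := hα' (conjCovec (γ ∘ₗ projOneZero hJ))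
    rw [conjCovec_conjCovec, hpi, hpi', map_zero, mul_zero, zero_add] at h
    exact (map_eq_zero _).1 ((mul_eq_zero.1 h).resolve_left (div_ne_zero hl.1 two_ne_zero))
  refine LinearMap.ext fun t => ?_
  rw [← projOneZero_add_conj hJ t, map_add]
  have e1 := LinearMap.congr_fun h1 (projOneZero hJ t)
  have e2 := LinearMap.congr_fun h2 (projOneZero hJ (conjVec t))
  simp only [LinearMap.comp_apply, conjCovec_apply, LinearMap.zero_apply, map_eq_zero] at e1 e2
  exact (congrArg₂ (· + ·) e1 e2).trans (by simp)

end Complexification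

/-! ### Ranks along the pencil, on the cross and at real parameters. -/

section Pencil

variable {V : Type*} [AddCommGroup V] [Module ℝ V]

theorem pencil_one_I (b : Bivector ℂ (ℂ ⊗[ℝ] V)) : pencil b (1, Complex.I) = b := by
  rw [pencil_eq]
  simp only [Complex.I_mul_I]
  module

/-- For real `s`, `t` the numbers `s ± it` vanish only when both are zero. -/
theorem notMem_cross_of_real {s t : ℝ} (h : s ≠ 0 ∨ t ≠ 0) : ((s, t) : ℂ × ℂ) ∉ cross := by
  rw [mem_cross_iff]
  simp only [Complex.ext_iff]
  simp
  tauto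

theorem exists_smul_eq_pencil_of_mem_cross (b : Bivector ℂ (ℂ ⊗[ℝ] V)) {l : ℂ × ℂ}
    (hl : l ∈ cross) (hl0 : l ≠ 0) :
    ∃ a : ℂ, a ≠ 0 ∧ (pencil b l = a • b ∨ pencil b l = a • conjBivector b) := by
  have hne : ¬ (l.1 + Complex.I * l.2 = 0 ∧ l.1 - Complex.I * l.2 = 0) := by
    rintro ⟨h1, h2⟩
    refine hl0 (Prod.ext ?_ ?_)
    · simp only [Prod.fst_zero]
      linear_combination (1 / 2 : ℂ) * h1 + (1 / 2 : ℂ) * h2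
    · have : Complex.I * l.2 = 0 := by
        linear_combination (1 / 2 : ℂ) * h1 - (1 / 2 : ℂ) * h2
      exact (mul_eq_zero.1 this).resolve_left Complex.I_ne_zero
  rw [pencil_eq]
  rcases (mem_cross_iff l).1 hl with h | h
  · refine ⟨(l.1 - Complex.I * l.2) / 2, div_ne_zero (fun h' => hne ⟨h, h'⟩) two_ne_zero, .inl ?_⟩
    rw [h, zero_div, zero_smul, add_zero]
  · refine ⟨(l.1 + Complex.I * l.2) / 2, div_ne_zero (fun h' => hne ⟨h', h⟩) two_ne_zero, .inr ?_⟩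
    rw [h, zero_div, zero_smul, zero_add]

variable [FiniteDimensional ℝ V]

theorem rank_conjBivector (b : Bivector ℂ (ℂ ⊗[ℝ] V)) :
    Bivector.rank (conjBivector b) = Bivector.rank b := by
  have h1 := Bivector.rank_add_codimChar b
  have h2 := Bivector.rank_add_codimChar (conjBivector b)
  rw [codimChar_conjBivector] at h2
  omega

theorem rank_pencil_of_mem_cross (b : Bivector ℂ (ℂ ⊗[ℝ] V)) {l : ℂ × ℂ}
    (hl : l ∈ cross) (hl0 : l ≠ 0) : Bivector.rank (pencil b l) = Bivector.rank b := by
  obtain ⟨a, ha, h | h⟩ := exists_smul_eq_pencil_of_mem_cross b hl hl0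
  · rw [h, Bivector.rank_smul ha]
  · rw [h, Bivector.rank_smul ha, rank_conjBivector]

theorem exists_real_rank_pencil_le (b : Bivector ℂ (ℂ ⊗[ℝ] V)) (l : ℂ × ℂ) :
    ∃ s t : ℝ, Bivector.rank (pencil b l) ≤ Bivector.rank (pencil b (s, t)) := by
  -- With `l = u + iv` for real vectors `u`, `v`, the pencil along `u + z v` passes through `l` at
  -- `z = i` and through real parameters at real `z`.
  obtain ⟨t, ht⟩ := exists_real_finrank_range_le
    (pencil b (l.1.re, l.2.re)).1 (pencil b (l.1.im, l.2.im)).1 Complex.I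
  have h (z : ℂ) : (pencil b (l.1.re, l.2.re)).1 + z • (pencil b (l.1.im, l.2.im)).1 =
      (pencil b (l.1.re + z * l.1.im, l.2.re + z * l.2.im)).1 := by
    refine congrArg Subtype.val (?_ : pencil b (l.1.re, l.2.re) + z • pencil b (l.1.im, l.2.im) = _)
    simp only [pencil]
    module
  rw [h, h] at ht
  refine ⟨l.1.re + t * l.1.im, l.2.re + t * l.2.im, ?_⟩
  rw [Bivector.rank_eq, Bivector.rank_eq]
  have hl : l = (l.1.re + Complex.I * l.1.im, l.2.re + Complex.I * l.2.im) :=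
    Prod.ext (by simp [mul_comm Complex.I]) (by simp [mul_comm Complex.I])
  rw [← hl] at ht
  rw [Complex.ofReal_add, Complex.ofReal_add, Complex.ofReal_mul, Complex.ofReal_mul]
  exact ht

end Pencil

/-! ### Complex combinations of a pair of fields. -/

section Span

variable {N A : Type*} [AddCommMonoid A] [Module ℂ A] [Module ℝ A] [IsScalarTower ℝ ℂ A]

omit [Module ℝ A] [IsScalarTower ℝ ℂ A] in
theorem smul_zero_add_smul_zero (a b : ℂ) : a • (0 : A) + b • (0 : A) = 0 := by
  rw [smul_zero, smul_zero, add_zero]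

theorem forall_mem_span_span_pair (f g : N → A) (P : (N → A) → Prop) :
    (∀ Z ∈ Submodule.span ℂ (Submodule.span ℝ {f, g} : Set (N → A)), Z ≠ 0 → P Z) ↔
      ∀ l : ℂ × ℂ, (∃ y, l.1 • f y + l.2 • g y ≠ 0) → P fun y => l.1 • f y + l.2 • g y := by
  rw [Submodule.span_span_of_tower]
  constructor
  · rintro h l ⟨y, hy⟩
    exact h _ (Submodule.mem_span_pair.2 ⟨l.1, l.2, rfl⟩) fun h0 => hy (congrFun h0 y)
  · intro h Z hZ hZ0
    obtain ⟨a, b, rfl⟩ := Submodule.mem_span_pair.1 hZ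
    refine h (a, b) ?_
    by_contra! h0
    exact hZ0 (funext h0)

/-- Real vectors that are linearly independent over `ℝ` are linearly independent over `ℂ`. -/
theorem eq_zero_of_smul_add_smul_eq_zero {f g : N → A} (h : LinearIndependent ℝ ![f, g])
    {l : ℂ × ℂ} (hl : ∀ y, l.1 • f y + l.2 • g y = 0)
    (hl' : ∀ y, (starRingEnd ℂ) l.1 • f y + (starRingEnd ℂ) l.2 • g y = 0) : l = 0 := by
  rw [LinearIndependent.pair_iffₛ] at h
  have hsmul (r : ℝ) (v : A) : r • v = (r : ℂ) • v := by
    rw [← smul_one_smul ℂ r v, Complex.real_smul, mul_one]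
  -- Half the sum of the two relations is a real relation with coefficients `Re l`; their difference
  -- divided by `2i` has coefficients `Im l`.
  have h1 := h l.1.re l.2.re 0 0 <| funext fun y => by
    simp only [Pi.add_apply, Pi.smul_apply, Pi.zero_apply, zero_smul, add_zero, hsmul,
      Complex.re_eq_add_conj]
    calc _ = (1 / 2 : ℂ) • (l.1 • f y + l.2 • g y) +
        (1 / 2 : ℂ) • ((starRingEnd ℂ) l.1 • f y + (starRingEnd ℂ) l.2 • g y) := by module
      _ = 0 := by rw [hl, hl', smul_zero, add_zero]
  have h2 := h l.1.im l.2.im 0 0 <| funext fun y => by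
    simp only [Pi.add_apply, Pi.smul_apply, Pi.zero_apply, zero_smul, add_zero, hsmul,
      Complex.im_eq_sub_conj]
    calc _ = (1 / (2 * Complex.I) : ℂ) • (l.1 • f y + l.2 • g y) +
        (-(1 / (2 * Complex.I)) : ℂ) •
          ((starRingEnd ℂ) l.1 • f y + (starRingEnd ℂ) l.2 • g y) := by module
      _ = 0 := by rw [hl, hl', smul_zero, smul_zero, add_zero]
  exact Prod.ext (Complex.ext h1.1 h2.1) (Complex.ext h1.2 h2.2)

end Span

/-! ### Completeness at a point in terms of coranks. -/

section Complete

variable {V : Type*} [AddCommGroup V] [Module ℝ V] {N : Type*} (b : N → Bivector ℂ (ℂ ⊗[ℝ] V))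

/-- The real span of the real and imaginary parts of a field of bivectors. -/
abbrev reImSpan : Submodule ℝ (N → Bivector ℂ (ℂ ⊗[ℝ] V)) :=
  Submodule.span ℝ {fun y => reBivector (b y), fun y => imBivector (b y)}

/-- The maximal rank of the members of `reImSpan b`. -/
abbrev reImMaxRank [FiniteDimensional ℝ V] : ℕ :=
  sSup {r | ∃ Z ∈ reImSpan b, ∃ y, r = Bivector.rank (Z y)}

theorem pencil_mem_reImSpan (s t : ℝ) : (fun y => pencil (b y) (s, t)) ∈ reImSpan b := by
  rw [Submodule.mem_span_pair]
  exact ⟨s, t, rfl⟩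

instance isScalarTower_bivector : IsScalarTower ℝ ℂ (Bivector ℂ (ℂ ⊗[ℝ] V)) :=
  ⟨fun r a Z => by
    rw [Complex.real_smul, mul_smul]
    rfl⟩

/-- The real and imaginary parts are fixed by conjugation, so conjugating a complex relation between
them gives the conjugate relation needed to separate real and imaginary coefficients. -/
theorem eq_zero_of_pencil_eq_zero
    (h : LinearIndependent ℝ ![fun y => reBivector (b y), fun y => imBivector (b y)])
    {l : ℂ × ℂ} (hl : ∀ y, pencil (b y) l = 0) : l = 0 := by
  have hconj (y : N) :
      (starRingEnd ℂ) l.1 • reBivector (b y) + (starRingEnd ℂ) l.2 • imBivector (b y) = 0 := by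
    have := congrArg conjBivector (hl y)
    rwa [pencil, conjBivector_add, conjBivector_smul, conjBivector_smul, conjBivector_reBivector,
      conjBivector_imBivector, conjBivector_zero] at this
  exact eq_zero_of_smul_add_smul_eq_zero h hl hconj

theorem pencil_eq_zero {c : Bivector ℂ (ℂ ⊗[ℝ] V)} (hre : reBivector c = 0)
    (him : imBivector c = 0) (l : ℂ × ℂ) : pencil c l = 0 := by
  rw [pencil, hre, him]
  exact smul_zero_add_smul_zero _ _

theorem pencil_zero_right (c : Bivector ℂ (ℂ ⊗[ℝ] V)) : pencil c 0 = 0 := by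
  rw [pencil, Prod.fst_zero, Prod.snd_zero, zero_smul, zero_smul, add_zero]

variable [FiniteDimensional ℝ V]

theorem rank_pencil_le_reImMaxRank (l : ℂ × ℂ) (y : N) :
    Bivector.rank (pencil (b y) l) ≤ reImMaxRank b := by
  obtain ⟨s, t, h⟩ := exists_real_rank_pencil_le (b y) l
  -- The supremum over natural numbers is meaningful only because ranks are bounded by the
  -- dimension.
  refine h.trans (le_csSup ⟨Module.finrank ℂ (ℂ ⊗[ℝ] V), ?_⟩
    ⟨_, pencil_mem_reImSpan b s t, y, rfl⟩)
  rintro _ ⟨b', -, y', rfl⟩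
  exact Bivector.rank_le _

theorem forall_rank_eq_reImSpan_iff_rank (x' : N) :
    (∀ Z ∈ Submodule.span ℂ (reImSpan b : Set (N → Bivector ℂ (ℂ ⊗[ℝ] V))), Z ≠ 0 →
      Bivector.rank (Z x') = reImMaxRank b) ↔ ∀ l, (∃ y, pencil (b y) l ≠ 0) →
      Bivector.rank (pencil (b x') l) = reImMaxRank b :=
  forall_mem_span_span_pair _ _ _

theorem reImMaxRank_le [Nonempty N] (r : ℕ)
    (h : ∀ (s t : ℝ) (y : N), Bivector.rank (pencil (b y) (s, t)) ≤ r) :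
    reImMaxRank b ≤ r := by
  refine csSup_le ⟨_, _, pencil_mem_reImSpan b 1 0, Classical.arbitrary N, rfl⟩ ?_
  rintro _ ⟨Z, hZ, y, rfl⟩
  rw [Submodule.mem_span_pair] at hZ
  obtain ⟨s, t, rfl⟩ := hZ
  exact h s t y

/-- Completeness of the pencil of `b` at a point in terms of the coranks of its members. -/
theorem forall_rank_eq_reImSpan_iff 
    (hb : LinearIndependent ℝ ![fun y => reBivector (b y), fun y => imBivector (b y)] ∨
      ((fun y => reBivector (b y)) = 0 ∧ (fun y => imBivector (b y)) = 0)) (x' : N) :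
    (∀ Z ∈ Submodule.span ℂ (reImSpan b : Set (N → Bivector ℂ (ℂ ⊗[ℝ] V))), Z ≠ 0 →
      Bivector.rank (Z x') = reImMaxRank b) ↔ ∃ k : ℕ,
      (∀ l ∉ cross, Bivector.codimChar (pencil (b x') l) = k) ∧
      Bivector.codimChar (b x') = k ∧
      ∀ l ∉ cross, IsLeast (Set.range fun y => Bivector.codimChar (pencil (b y) l)) k := by
  have hdim (c : Bivector ℂ (ℂ ⊗[ℝ] V)) := Bivector.rank_add_codimChar c
  rw [forall_rank_eq_reImSpan_iff_rank]
  constructor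
  · intro h
    -- In the independent case no nonzero `l` gives the zero field, so completeness applies to all
    -- of them; `l = (1, i)` recovers `b` itself. In the other case every rank is zero.
    have key : ∀ l ≠ 0, ∀ y, Bivector.rank (pencil (b y) l) ≤ Bivector.rank (b x') ∧
        Bivector.rank (pencil (b x') l) = Bivector.rank (b x') := by
      intro l hl y
      rcases hb with hb | ⟨h1, h2⟩
      · have hr : ∀ l ≠ 0, Bivector.rank (pencil (b x') l) = reImMaxRank b := by
          intro l hl
          refine h l ?_
          by_contra! h0
          exact hl (eq_zero_of_pencil_eq_zero b hb h0)
        have hx : Bivector.rank (b x') = reImMaxRank b := by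
          rw [← hr (1, Complex.I) (by simp), pencil_one_I]
        rw [hr l hl, hx]
        exact ⟨rank_pencil_le_reImMaxRank b l y, rfl⟩
      · have h0 (l : ℂ × ℂ) (y : N) : pencil (b y) l = 0 := by
          have e1 : reBivector (b y) = 0 := congrFun h1 y
          have e2 : imBivector (b y) = 0 := congrFun h2 y
          exact pencil_eq_zero e1 e2 l
        have hx : b x' = 0 := by rw [← pencil_one_I (b x'), h0]
        rw [h0, h0, hx]
        exact ⟨le_rfl, rfl⟩
    have hne (l : ℂ × ℂ) (hl : l ∉ cross) : l ≠ 0 := by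
      rintro rfl
      exact hl ((mem_cross_iff _).2 (by simp))
    have hk (l : ℂ × ℂ) (hl : l ∉ cross) :
        Bivector.codimChar (pencil (b x') l) = Bivector.codimChar (b x') := by
      have h1 := (key l (hne l hl) x').2
      have h2 := hdim (b x')
      have h3 := hdim (pencil (b x') l)
      omega
    refine ⟨Bivector.codimChar (b x'), hk, rfl, fun l hl => ⟨⟨x', hk l hl⟩, ?_⟩⟩
    rintro _ ⟨y, rfl⟩
    have h1 := (key l (hne l hl) y).1
    have h2 := hdim (b x')
    have h3 := hdim (pencil (b y) l)
    change _ ≤ Bivector.codimChar (pencil (b y) l)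
    omega
  · rintro ⟨k, h1, h2, h3⟩
    -- Nonzero real parameters lie off the cross, so minimality of `k` bounds all their ranks by
    -- that of `b x'`. The zero parameter lies on the cross and is treated separately.
    have hmax : reImMaxRank b = Bivector.rank (b x') := by
      apply le_antisymm
      · have : Nonempty N := ⟨x'⟩
        refine reImMaxRank_le b _ fun s t y => ?_
        by_cases hst : s ≠ 0 ∨ t ≠ 0
        · have e1 := (h3 _ (notMem_cross_of_real hst)).2 ⟨y, rfl⟩
          have e2 := hdim (b x')
          have e3 := hdim (pencil (b y) (s, t))
          change k ≤ Bivector.codimChar (pencil (b y) (s, t)) at e1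
          omega
        · push Not at hst
          obtain ⟨rfl, rfl⟩ := hst
          have : pencil (b y) (((0 : ℝ) : ℂ), ((0 : ℝ) : ℂ)) = 0 := pencil_zero_right _
          rw [this, Bivector.rank_zero]
          exact Nat.zero_le _
      · have := rank_pencil_le_reImMaxRank b (1, Complex.I) x'
        rwa [pencil_one_I] at this
    rintro l ⟨y, hy⟩
    have hl0 : l ≠ 0 := by
      rintro rfl
      exact hy (pencil_zero_right _)
    rw [hmax]
    -- On the cross the member is a nonzero multiple of `b` or its conjugate; off it, the equality
    -- of coranks with `k` applies.
    by_cases hl : l ∈ cross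
    · exact rank_pencil_of_mem_cross _ hl hl0
    · have e1 := h1 l hl
      have e2 := hdim (b x')
      have e3 := hdim (pencil (b x') l)
      omega

end Complete

/-! ### The geometric inputs and the two corank formulas. -/

section Manifold

variable {E : Type*} [NormedAddCommGroup E] [NormedSpace ℂ E]

theorem formExt_tmul (η : E [⋀^Fin 2]→L[ℂ] ℂ) (a b : ℂ) (u v : E) :
    (formExt η).1 (a ⊗ₜ u) (b ⊗ₜ v) = a * b * η ![u, v] := by
  have h : (formExt η).1 (a ⊗ₜ u) = a • LinearMap.liftBaseChangeEquiv ℂ (realBilinear η u) :=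
    LinearMap.liftBaseChange_tmul ℂ _ a u
  rw [h, LinearMap.smul_apply, smul_eq_mul, mul_assoc]
  exact congrArg (a * ·) (LinearMap.liftBaseChange_tmul ℂ (realBilinear η u) b v)

theorem complexStructure_sq (v : E) : complexStructure E (complexStructure E v) = -v := by
  change Complex.I • Complex.I • v = -v
  rw [smul_smul, Complex.I_mul_I, neg_one_smul]

/-- Each of the four terms of the expansion contributes one `η(u, v)`, by complex bilinearity. This
transfers nondegeneracy from `E` to the (1,0)-part. -/
theorem formExt_oneZero (η : E [⋀^Fin 2]→L[ℂ] ℂ) (u v : E) :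
    (formExt η).1 ((1 : ℂ) ⊗ₜ u - Complex.I ⊗ₜ complexStructure E u)
      ((1 : ℂ) ⊗ₜ v - Complex.I ⊗ₜ complexStructure E v) = 4 * η ![u, v] := by
  have h1 (u v : E) : η ![complexStructure E u, v] = Complex.I * η ![u, v] :=
    η.toAlternatingMap.map_vecCons_smul ![v] Complex.I u
  have h2 (u v : E) : η ![u, complexStructure E v] = Complex.I * η ![u, v] := by
    have hup (w : E) : Function.update ![u, v] 1 w = ![u, w] := by
      ext i; fin_cases i <;> rfl
    have h := η.map_update_smul ![u, v] 1 Complex.I v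
    rwa [hup, hup] at h
  simp only [map_sub, LinearMap.sub_apply, formExt_tmul, h1, h2]
  linear_combination (Complex.I * Complex.I - 3) * η ![u, v] * Complex.I_mul_I

variable {M : Type*} [TopologicalSpace M] [ChartedSpace E M]

variable {E' : Type*} [NormedAddCommGroup E'] [NormedSpace ℝ E']
  {M' : Type*} [TopologicalSpace M'] [ChartedSpace E' M'] {p : M → M'}

theorem leafTangentC_eq_ker (hp : IsConnectedSubmersion E E' p) (x : M) :
    leafTangentC E E' p x = LinearMap.ker ((realDiff p x : E →ₗ[ℝ] E').baseChange ℂ) :=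
  (ker_baseChange_eq _ (hp.submersion x)).symm

/-- For a generic CR-foliation the differential of `p` is already surjective on the
(1,0)-part. -/
theorem surjective_oneZero (hp : IsConnectedSubmersion E E' p)
    (hCR : IsGenericCRFoliation E E' p) (x : M) :
    Function.Surjective (((realDiff p x : E →ₗ[ℝ] E').baseChange ℂ) ∘ₗ
      (typeOneZero (complexStructure E)).subtype) := by
  rw [← LinearMap.range_eq_top, eq_top_iff]
  intro w' _
  induction w' using TensorProduct.induction_on with
  | zero => exact Submodule.zero_mem _
  | add u v hu hv => exact Submodule.add_mem _ (hu trivial) (hv trivial)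
  | tmul a e' =>
    obtain ⟨v, rfl⟩ := hp.submersion x e'
    have hv : v ∈ leafTangent E E' p x ⊔ (leafTangent E E' p x).map (complexStructure E) := by
      rw [hCR.generic x]; trivial
    obtain ⟨k₁, hk₁, _, ⟨k₂, hk₂, rfl⟩, rfl⟩ := Submodule.mem_sup.1 hv
    have hk₁' : realDiff p x k₁ = (0 : E') := hk₁
    have hk₂' : realDiff p x k₂ = (0 : E') := hk₂
    -- With `v = k₁ + J k₂`, the (1,0)-vector `k₂ - iJk₂` is sent to `-i p_*(J k₂) = -i p_* v`; the
    -- factor `a i` turns this into `a ⊗ p_* v`.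
    refine ⟨(a * Complex.I) • ⟨_, tmul_sub_mem_typeOneZero complexStructure_sq k₂⟩, ?_⟩
    rw [map_smul, LinearMap.comp_apply, Submodule.subtype_apply, map_sub,
      LinearMap.baseChange_tmul, LinearMap.baseChange_tmul, hk₂', map_add, hk₁', zero_add,
      TensorProduct.tmul_zero, zero_sub, smul_neg, TensorProduct.smul_tmul', smul_eq_mul,
      mul_assoc, Complex.I_mul_I, mul_neg_one, TensorProduct.neg_tmul, neg_neg]

variable [FiniteDimensional ℂ E] [FiniteDimensional ℝ E']

theorem HolomorphicSymplecticForm.form_oneZero_bijective (Ω : HolomorphicSymplecticForm E M)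
    (x : M) : Function.Bijective
      (TwoForm.comap (typeOneZero (complexStructure E)).subtype (Ω.form x)).1 := by
  have : FiniteDimensional ℝ E := FiniteDimensional.complexToReal E
  set B := TwoForm.comap (typeOneZero (complexStructure E)).subtype (Ω.form x)
  have hinj : Function.Injective B.1 := by
    rw [← LinearMap.ker_eq_bot, LinearMap.ker_eq_bot']
    intro t ht
    obtain ⟨w, hw⟩ := exists_tmul_sub_eq complexStructure_sq t
    have hw0 : w = 0 := Ω.nondegenerate x w fun (v : E) => by
      have h := LinearMap.congr_fun ht
        ⟨_, tmul_sub_mem_typeOneZero complexStructure_sq (v : E)⟩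
      have h' : (Ω.form x).1 (t : ℂ ⊗[ℝ] E)
        ((1 : ℂ) ⊗ₜ (v : E) - Complex.I ⊗ₜ complexStructure E (v : E)) = 0 := h
      rw [hw, HolomorphicSymplecticForm.form] at h'
      have h4 := (formExt_oneZero (E := E) (Ω.toFun x) w v).symm.trans h'
      exact (mul_eq_zero.1 h4).resolve_left (by norm_num : (4 : ℂ) ≠ 0)
    refine Subtype.ext ?_
    rw [hw, hw0]
    simp
  exact ⟨hinj, (LinearMap.injective_iff_surjective_of_finrank_eq_finrank
    Subspace.dual_finrank_eq.symm).1 hinj⟩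

/-- `finrank_ker_inf_perp` on the whole complexified tangent space: passing to the pencil commutes
with the real map `p_*`, and the kernel of the complexified `p_*` is the complexified leaf tangent
space. -/
theorem kLam_eq_codimChar (Ω : HolomorphicSymplecticForm E M)
    (hp : IsConnectedSubmersion E E' p) (hc : IsProjectable E' p Ω.bivector) (x : M)
    {l : ℂ × ℂ} (hl : l ∉ cross) :
    kLam E' Ω p l x = Bivector.codimChar (pencil (pushForward E' p Ω.bivector (p x)) l) := by
  have : FiniteDimensional ℝ E := FiniteDimensional.complexToReal E
  have hB := Ω.form_oneZero_bijective x
  have hnd : Function.Bijective (Bivector.sharp (pencil (Ω.bivector x) l)) := by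
    refine pencil_sharp_bijective complexStructure_sq _ (fun γ hγ => ?_) hl
    obtain ⟨u, rfl⟩ := hB.2 γ
    have hu : (TwoForm.comap (typeOneZero (complexStructure E)).subtype (Ω.form x)).1 u = 0 :=
      LinearMap.ext fun v => by
        rw [← TwoForm.inverse_apply _ hB]
        exact hγ _
    exact hu
  rw [pushForward_apply hp hc, pushAt, pencil_map_baseChange,
    ← finrank_ker_inf_perp _ (Bivector.inverse_bijective _ hnd) _ (Bivector.apply_inverse _ hnd) _
      (LinearMap.lTensor_surjective ℂ (hp.submersion x)), kLam, leafTangentC_eq_ker hp]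

/-- `finrank_ker_inf_perp` on the (1,0)-part, where the restriction of `p_*` is onto and has kernel
`T^{1,0} K`. What remains is to move the intersection from the (1,0)-part into the ambient space. -/
theorem kHol_eq_codimChar (Ω : HolomorphicSymplecticForm E M)
    (hp : IsConnectedSubmersion E E' p) (hCR : IsGenericCRFoliation E E' p)
    (hc : IsProjectable E' p Ω.bivector) (x : M) :
    kHol E' Ω p x = Bivector.codimChar (pushForward E' p Ω.bivector (p x)) := by
  have : FiniteDimensional ℝ E := FiniteDimensional.complexToReal E
  have hB := Ω.form_oneZero_bijective x
  rw [pushForward_apply hp hc, pushAt, HolomorphicSymplecticForm.bivector, Bivector.map_map,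
    ← finrank_ker_inf_perp _ hB _ (TwoForm.inverse_apply _ hB) _ (surjective_oneZero hp hCR x),
    kHol]
  have hι : Function.Injective (typeOneZero (complexStructure E)).subtype :=
    Submodule.subtype_injective _
  rw [(Submodule.equivMapOfInjective _ hι (_ ⊓ _)).finrank_eq]
  have hmem (t : ℂ ⊗[ℝ] E) : t ∈ leafOneZero E E' p x ↔
      t ∈ LinearMap.ker ((realDiff p x : E →ₗ[ℝ] E').baseChange ℂ) ∧
        t ∈ typeOneZero (complexStructure E) := by
    rw [leafOneZero, Submodule.mem_inf, leafTangentC_eq_ker hp]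
  suffices h : leafOneZero E E' p x ⊓ (typeOneZero (complexStructure E) ⊓
      TwoForm.perp (Ω.form x) (leafOneZero E E' p x)) =
    (LinearMap.ker (((realDiff p x : E →ₗ[ℝ] E').baseChange ℂ) ∘ₗ
        (typeOneZero (complexStructure E)).subtype) ⊓
      TwoForm.perp (TwoForm.comap (typeOneZero (complexStructure E)).subtype (Ω.form x))
        (LinearMap.ker (((realDiff p x : E →ₗ[ℝ] E').baseChange ℂ) ∘ₗ
          (typeOneZero (complexStructure E)).subtype))).map
      (typeOneZero (complexStructure E)).subtype by rw [h]
  ext t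
  constructor
  · rintro ⟨h1, h2, h3⟩
    exact ⟨⟨t, h2⟩, ⟨((hmem t).1 h1).1, fun v hv => h3 v.1 ((hmem _).2 ⟨hv, v.2⟩)⟩, rfl⟩
  · rintro ⟨t, ⟨h1, h2⟩, rfl⟩
    exact ⟨(hmem _).2 ⟨h1, t.2⟩, t.2, fun v hv => h2 ⟨v, ((hmem v).1 hv).2⟩ ((hmem v).1 hv).1⟩

end Manifold

end SymplecticReduction

end

theorem mainTheorem2
    {E : Type*} [NormedAddCommGroup E] [NormedSpace ℂ E] [FiniteDimensional ℂ E]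
    {M : Type*} [TopologicalSpace M] [ChartedSpace E M] [IsManifold 𝓘(ℂ, E) ∞ M]
    {E' : Type*} [NormedAddCommGroup E'] [NormedSpace ℝ E'] [FiniteDimensional ℝ E']
    {M' : Type*} [TopologicalSpace M'] [ChartedSpace E' M'] [IsManifold 𝓘(ℝ, E') ∞ M']
    (Ω : HolomorphicSymplecticForm E M) (p : M → M') (hp : IsConnectedSubmersion E E' p)
    (hCR : IsGenericCRFoliation E E' p) (hc : IsProjectable E' p Ω.bivector) :
    (∀ x : M, ∀ l ∉ cross,
      kLam E' Ω p l x = Bivector.codimChar (pencil (pushForward E' p Ω.bivector (p x)) l)) ∧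
    (∀ x : M,
      kHol E' Ω p x = Bivector.codimChar (pushForward E' p Ω.bivector (p x)) ∧
      kHol E' Ω p x = Bivector.codimChar (conjBivector (pushForward E' p Ω.bivector (p x)))) ∧
    (IndepOrZero (pushForward E' p Ω.bivector) →
      ∀ (x' : M') (x : M), p x = x' →
        (IsCompleteAt (pencilSpan (pushForward E' p Ω.bivector)) x' ↔
          ∃ k : ℕ,
            (∀ l ∉ cross, kLam E' Ω p l x = k) ∧
            kHol E' Ω p x = k ∧
            (∀ l ∉ cross, IsLeast (Set.range (fun y : M => kLam E' Ω p l y)) k))) := by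
  have h1 (x : M) (l : ℂ × ℂ) (hl : l ∉ cross) := kLam_eq_codimChar Ω hp hc x hl
  have h2 (x : M) := kHol_eq_codimChar Ω hp hCR hc x
  refine ⟨h1, fun x => ⟨h2 x, by rw [h2 x, codimChar_conjBivector]⟩, ?_⟩
  rintro hind _ x rfl
  refine (forall_rank_eq_reImSpan_iff _ hind _).trans ?_
  refine exists_congr fun k => and_congr ?_ (and_congr (by rw [h2 x]) ?_)
  · exact forall₂_congr fun l hl => by rw [h1 x l hl]
  · refine forall₂_congr fun l hl => ?_
    -- Since `p` is onto and `k_λ` factors through it, minimizing over `M` and over `M'` is the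
    -- same.
    have hrange : Set.range (fun y : M => kLam E' Ω p l y) = Set.range fun y : M' =>
        Bivector.codimChar (pencil (pushForward E' p Ω.bivector y) l) := by
      rw [← hp.surjective.range_comp]
      exact congrArg Set.range (funext fun y => h1 y l hl)
    rw [hrange]
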